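/- Let $\mathcal X,\mathcal Y$ be finite sets and let $p_{X,Y}$ be a probability distribution on $\mathcal X\times\mathcal Y$ with $p_X(x)>0$ and $p_Y(y)>0$ for all $x,y$. Let $p_N$ be a distribution on $\mathcal Y$ with $p_N(y)>0$ for all $y$, let $K\ge 1$ be an integer, let $\Theta\subset\mathbb R^d$ be compact, and for each $(x,y)$ let $\theta\mapsto s(x,y;\theta)$ be twice continuously differentiable on $\Theta$. Put $Z(x;\theta)=\sum_{y\in\mathcal Y}e^{s(x,y;\theta)}$ and $\bar s(x,y;\theta)=s(x,y;\theta)-\log p_N(y)$. Assume that $\theta^*\in\Theta$ satisfies the following. 1. For all $(x,y)$, $p_{Y|X}(y\mid x)=e^{s(x,y;\theta^*)}/Z(x;\theta^*)$. 2. (Identifiability) If $\theta\in\Theta$ and there is a function $c$ on $\mathcal X$ with $s(x,y;\theta)-s(x,y;\theta^*)=c(x)$ for all $(x,y)$, then $\theta=\theta^*$. 3. The set $\arg\max_{\theta\in\Theta}L_R^\infty(\theta)$ is contained in the interior of $\Theta$, where $$L_R^\infty(\theta)=\sum_{x,y_0,\dots,y_K}p_{X,Y}(x,y_0)\prod_{i=1}^Kp_N(y_i)\,\log\frac{e^{\bar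 s(x,y_0;\theta)}}{\sum_{k=0}^Ke^{\bar s(x,y_k;\theta)}} .$$ 4. The $d\times d$ matrix $\mathcal I_{\theta^*}=\mathbb E_X\big[\operatorname{Var}_{Y|X}[\nabla_\theta s(X,Y;\theta^*)]\big]$, where $\operatorname{Var}_{Y|X=x}$ denotes the covariance matrix under $p_{Y|X}(\cdot\mid x)$, is nonsingular. Let $(x^{(i)},y^{(i)})$, $i\ge 1$, be i.i.d. from $p_{X,Y}$, and for each $n$ let the random vector $\hat\theta_n^{\mathrm{MLE}}$ be (almost surely) a maximizer over $\theta\in\Theta$ of the conditional log-likelihood $$\sum_{i=1}^n\log\frac{e^{s(x^{(i)},y^{(i)};\theta)}}{Z(x^{(i)};\theta)} .$$ Then, as $n\to\infty$, $$\sqrt n\,\big(\hat\theta_n^{\mathrm{MLE}}-\theta^*\big)\;\Rightarrow\;\mathcal N\big(0,\mathcal I_{\theta^*}^{-1}\big)$$ in distribution. -/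

import Mathlib

open MeasureTheory ProbabilityTheory Filter

noncomputable section

namespace CondModel

variable {X Y : Type*} [Fintype X] [Fintype Y] {d : ℕ}

/-- The parameter space `ℝᵈ` with its Euclidean norm. -/
abbrev Param (d : ℕ) : Type := EuclideanSpace ℝ (Fin d)

/-- The joint probability `p_{X,Y}(x, y)`. -/
def jointProb (p : PMF (X × Y)) (x : X) (y : Y) : ℝ := (p (x, y)).toReal

/-- The marginal probability `p_X(x)`. -/
def marginalX (p : PMF (X × Y)) (x : X) : ℝ := ∑ y, jointProb p x y

/-- The marginal probability `p_Y(y)`. -/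
def marginalY (p : PMF (X × Y)) (y : Y) : ℝ := ∑ x, jointProb p x y

/-- The conditional probability `p_{Y|X}(y | x)`. -/
def condProb (p : PMF (X × Y)) (x : X) (y : Y) : ℝ := jointProb p x y / marginalX p x

/-- The partition function `Z(x; θ) = ∑ y, exp (s(x, y; θ))`. -/
def partitionFn (s : X → Y → Param d → ℝ) (x : X) (θ : Param d) : ℝ :=
  ∑ y, Real.exp (s x y θ)

/-- The model `exp (s(x, y; θ)) / Z(x; θ)` for the conditional probability of `y` given `x`. -/
def modelProb (s : X → Y → Param d → ℝ) (θ : Param d) (x : X) (y : Y) : ℝ :=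
  Real.exp (s x y θ) / partitionFn s x θ

/-- The conditional model is correctly specified at the parameter `θstar`. -/
def WellSpecified (p : PMF (X × Y)) (s : X → Y → Param d → ℝ) (θstar : Param d) : Prop :=
  ∀ x y, condProb p x y = modelProb s θstar x y

/-- Identifiability: only `θstar` itself gives, within `Θ`, the scores of `θstar` up to a
function of `x`. -/
def Identifiable (s : X → Y → Param d → ℝ) (Θ : Set (Param d)) (θstar : Param d) : Prop :=
  ∀ θ ∈ Θ, (∃ c : X → ℝ, ∀ x y, s x y θ - s x y θstar = c x) → θ = θstar

/-- The noise-corrected score `s(x, y; θ) - log p_N(y)`. -/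
def correctedScore (pN : PMF Y) (s : X → Y → Param d → ℝ) (x : X) (y : Y) (θ : Param d) : ℝ :=
  s x y θ - Real.log (pN y).toReal

/-- The population ranking objective of noise contrastive estimation with `K` negative samples:
the sum over `x, y₀, …, y_K` of `p_{X,Y}(x, y₀) ∏_{i=1}^K p_N(y_i)` times the logarithm of the
softmax weight of `y₀` among `y₀, …, y_K`. -/
def rankingObjective (p : PMF (X × Y)) (pN : PMF Y) (K : ℕ) (s : X → Y → Param d → ℝ)
    (θ : Param d) : ℝ :=
  ∑ x : X, ∑ y : Fin (K + 1) → Y,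
    (jointProb p x (y 0) * ∏ i : Fin K, (pN (y i.succ)).toReal) *
      Real.log (Real.exp (correctedScore pN s x (y 0) θ) /
        ∑ k : Fin (K + 1), Real.exp (correctedScore pN s x (y k) θ))

/-- The set of maximizers over `Θ` of the population ranking objective. -/
def rankingMaximizers (p : PMF (X × Y)) (pN : PMF Y) (K : ℕ) (s : X → Y → Param d → ℝ)
    (Θ : Set (Param d)) : Set (Param d) :=
  {θ ∈ Θ | IsMaxOn (rankingObjective p pN K s) Θ θ}

/-- The conditional log-likelihood of the first `n` observations `z 0, …, z (n - 1)`. -/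
def condLogLik (s : X → Y → Param d → ℝ) (n : ℕ) (z : ℕ → X × Y) (θ : Param d) : ℝ :=
  ∑ i ∈ Finset.range n, Real.log (modelProb s θ (z i).1 (z i).2)

/-- `θ` is a conditional maximum likelihood estimate over `Θ` from `z 0, …, z (n - 1)`. -/
def IsCondMLE (s : X → Y → Param d → ℝ) (Θ : Set (Param d)) (n : ℕ) (z : ℕ → X × Y)
    (θ : Param d) : Prop :=
  θ ∈ Θ ∧ IsMaxOn (condLogLik s n z) Θ θ

/-- The conditional mean `E_{Y|X=x}[g(Y)]`. -/
def condMean (p : PMF (X × Y)) (x : X) (g : Y → Param d) : Param d :=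
  ∑ y, condProb p x y • g y

/-- The conditional covariance matrix `Var_{Y|X=x}[g(Y)]`. -/
def condVar (p : PMF (X × Y)) (x : X) (g : Y → Param d) : Matrix (Fin d) (Fin d) ℝ :=
  Matrix.of fun a b => ∑ y, condProb p x y *
    ((g y a - condMean p x g a) * (g y b - condMean p x g b))

/-- The information matrix `E_X[Var_{Y|X}[∇_θ s(X, Y; θ)]]`. -/
def fisherInfo (p : PMF (X × Y)) (s : X → Y → Param d → ℝ) (θ : Param d) :
    Matrix (Fin d) (Fin d) ℝ :=
  ∑ x, marginalX p x • condVar p x (fun y => gradient (s x y) θ)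

end CondModel

end

/-! The proof is classical M-estimation, simplified by finiteness of the sample space: the
log-likelihood divided by `n` is a finite sum weighted by empirical frequencies, which converge
almost surely, so no uniform law of large numbers is needed. Gibbs' inequality and identifiability
make `θstar` the unique population maximizer, and compactness of `Θ` gives consistency. The ranking
objective serves only to place `θstar` in the interior: by Gibbs' inequality again, the true
parameter maximizes it. Hence the score equation eventually holds; linearizing it at `θstar` shows
that the estimation error is equivalent to the sample mean of `I⁻¹ • score`. The central limit
theorem gives a Gaussian limit, and the information identity (minus the mean Hessian equals the
second moment of the score) reduces its covariance to `I⁻¹`. The limit theorem is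
`tendstoInDistribution_mEstimator`; the rest verifies its hypotheses. -/

/-! ### Limit theorems in probability. -/

section Limit

open scoped Topology RealInnerProductSpace

variable {E Ω : Type*} [NormedAddCommGroup E] [InnerProductSpace ℝ E] [FiniteDimensional ℝ E]
  [MeasurableSpace E] [BorelSpace E] [MeasurableSpace Ω] {P : Measure Ω} [IsProbabilityMeasure P]

/-- The central limit theorem in a finite-dimensional inner product space. -/
theorem tendstoInDistribution_inv_sqrt_smul_sum {X : ℕ → Ω → E} {μ : Measure E}
    [IsProbabilityMeasure μ] (hindep : iIndepFun X P)
    (hident : ∀ i, IdentDistrib (X i) (X 0) P P) (hX : MemLp (X 0) 2 P)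
    (hmean : ∀ t, P[fun ω => ⟪X 0 ω, t⟫] = 0)
    (hμ : ∀ t, charFun μ t = Complex.exp (-(∫ ω, ⟪X 0 ω, t⟫ ^ 2 ∂P : ℝ) / 2)) :
    TendstoInDistribution (fun (n : ℕ) ω => (√(n : ℝ))⁻¹ • ∑ i ∈ Finset.range n, X i ω) atTop
      (id : E → E) (fun _ => P) μ := by
  have hmeas (n : ℕ) :
      AEMeasurable (fun ω => (√(n : ℝ))⁻¹ • ∑ i ∈ Finset.range n, X i ω) P :=
    (Finset.aemeasurable_fun_sum _ fun i _ => (hident i).aemeasurable_fst).const_smul _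
  refine ⟨hmeas, aemeasurable_id, ?_⟩
  refine ProbabilityMeasure.tendsto_iff_tendsto_charFun.2 fun t => ?_
  have hYmeas : Measurable fun x : E => ⟪x, t⟫ := by fun_prop
  have hvar : Var[fun ω => ⟪X 0 ω, t⟫; P] = ∫ ω, ⟪X 0 ω, t⟫ ^ 2 ∂P := by
    rw [variance_eq_integral (X := fun ω => ⟪X 0 ω, t⟫)
      (hYmeas.comp_aemeasurable (hident 0).aemeasurable_fst), hmean t]
    simp
  have hclt := tendstoInDistribution_inv_sqrt_mul_sum_sub (P := P)
    (P' := gaussianReal 0 Var[fun ω => ⟪X 0 ω, t⟫; P].toNNReal)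
    (X := fun i ω => ⟪X i ω, t⟫) (Y := id) ⟨aemeasurable_id, Measure.map_id⟩
    (hX.inner_const t)
    (hindep.comp (fun _ x => ⟪x, t⟫) fun _ => hYmeas) (fun i => (hident i).comp hYmeas)
  -- Cramér–Wold: the characteristic function at `t` is that of the projection onto `t`, evaluated
  -- at `1`.
  have h1 := ProbabilityMeasure.tendsto_iff_tendsto_charFun.1 hclt.tendsto 1
  have hlim : charFun ((gaussianReal 0 Var[fun ω => ⟪X 0 ω, t⟫; P].toNNReal).map id) 1
      = charFun (μ.map id) t := by
    rw [Measure.map_id, Measure.map_id, charFun_gaussianReal, hμ,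
      Real.coe_toNNReal _ (variance_nonneg _ _), hvar]
    simp [neg_div]
  simp only [ProbabilityMeasure.coe_mk] at h1 ⊢
  rw [hlim] at h1
  refine h1.congr fun n => ?_
  rw [charFun_apply, charFun_apply, integral_map (hclt.forall_aemeasurable n) (by fun_prop),
    integral_map (hmeas n) (by fun_prop)]
  congr 1 with ω
  simp [hmean t, inner_smul_left, sum_inner]

/-- Slutsky's theorem with a relative error: if `W n` converges in distribution and `D n - W n` is
almost surely negligible compared with `W n`, then `D n` has the same limit. -/
theorem tendstoInDistribution_of_ae_sub_isLittleO {Ω' : Type*} [MeasurableSpace Ω']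
    {P' : Measure Ω'} [IsProbabilityMeasure P'] {W D : ℕ → Ω → E} {G : Ω' → E}
    (hW : TendstoInDistribution W atTop G (fun _ => P) P') (hD : ∀ n, AEMeasurable (D n) P)
    (h : ∀ᵐ ω ∂P, (fun n => D n ω - W n ω) =o[atTop] fun n => W n ω) :
    TendstoInDistribution D atTop G (fun _ => P) P' := by
  have hpos (x : E) : (0 : ℝ) < 1 + ‖x‖ := by positivity
  -- Since `1 + ‖W n‖` never vanishes, `C n` is well behaved and tends to `0` almost surely; `D n`
  -- is then a continuous function of `(W n, C n)`.
  let C : ℕ → Ω → E := fun n ω => (1 + ‖W n ω‖)⁻¹ • (D n ω - W n ω)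
  have hC (n) : AEMeasurable (C n) P := by
    have := hW.forall_aemeasurable n
    have := hD n
    fun_prop
  have hC0 : TendstoInMeasure P C atTop fun _ => (0 : E) := by
    refine tendstoInMeasure_of_tendsto_ae (fun n => (hC n).aestronglyMeasurable) ?_
    filter_upwards [h] with ω hω
    have h1 : (fun n => D n ω - W n ω) =o[atTop] fun n => 1 + ‖W n ω‖ := by
      refine hω.trans_isBigO (Asymptotics.IsBigO.of_norm_le fun n => ?_)
      simp
    have h2 : (fun n => C n ω) =o[atTop] fun n => (1 + ‖W n ω‖)⁻¹ • (1 + ‖W n ω‖) :=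
      (Asymptotics.isBigO_refl _ _).smul_isLittleO h1
    refine (Asymptotics.isLittleO_one_iff ℝ).1 (h2.congr_right fun n => ?_)
    simpa using inv_mul_cancel₀ (hpos (W n ω)).ne'
  have h3 := hW.continuous_comp_prodMk_of_tendstoInMeasure_const
    (g := fun z : E × E => z.1 + (1 + ‖z.1‖) • z.2) (by fun_prop) hC0 hC
  refine h3.congr (fun n => .of_forall fun ω => ?_) (.of_forall fun ω => by simp)
  simp only [C]
  rw [smul_inv_smul₀ (hpos _).ne']
  abel

/-- In an i.i.d. sample from a distribution on a finite type, the empirical frequencies converge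
almost surely to the probabilities. -/
theorem ae_tendsto_empirical_frequency {A : Type*} [Fintype A] [DecidableEq A] [MeasurableSpace A]
    [MeasurableSingletonClass A] (p : PMF A) {Z : ℕ → Ω → A} (hindep : iIndepFun Z P)
    (hlaw : ∀ i, HasLaw (Z i) p.toMeasure P) :
    ∀ᵐ ω ∂P, ∀ a, Tendsto
      (fun n : ℕ => (∑ i ∈ Finset.range n, if Z i ω = a then (1 : ℝ) else 0) / n) atTop
      (𝓝 (p a).toReal) := by
  refine ae_all_iff.2 fun a => ?_
  let u : A → ℝ := fun z => if z = a then 1 else 0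
  have hu : Measurable u := measurable_of_finite u
  have hid (i) : IdentDistrib (Z i) (Z 0) P P := (hlaw i).identDistrib (hlaw 0)
  have hint : ∫ ω, u (Z 0 ω) ∂P = (p a).toReal := by
    rw [← integral_map (hlaw 0).aemeasurable hu.aestronglyMeasurable, (hlaw 0).map_eq,
      PMF.integral_eq_sum]
    simp [u]
  have hb : Integrable (fun ω => u (Z 0 ω)) P := by
    refine Integrable.of_bound (hu.comp_aemeasurable (hlaw 0).aemeasurable).aestronglyMeasurable 1
      (.of_forall fun ω => ?_)
    simp only [u]
    split_ifs <;> simp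
  have := strong_law_ae_real (μ := P) (fun i ω => u (Z i ω)) hb
    (fun i j hij => (hindep.indepFun hij).comp hu hu) (fun i => (hid i).comp hu)
  simpa only [hint] using this

end Limit

/-! ### Consistency and linearization along a fixed sequence of weights. -/

section Deterministic

open scoped Topology RealInnerProductSpace

variable {A : Type*} [Fintype A]

/-- Maximizers over a compact set of weighted sums converge to the unique maximizer for the limit
weights. -/
theorem tendsto_of_isMaxOn_weighted_sum {E : Type*} [TopologicalSpace E]
    {m : A → E → ℝ} {Θ : Set E} {θ₀ : E} (hΘ : IsCompact Θ)
    (hm : ∀ a, ContinuousOn (m a) Θ) {q : ℕ → A → ℝ} {w : A → ℝ}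
    (hq : ∀ a, Tendsto (fun n => q n a) atTop (𝓝 (w a))) (hθ₀ : θ₀ ∈ Θ)
    (huniq : ∀ θ ∈ Θ, ∑ a, w a * m a θ₀ ≤ ∑ a, w a * m a θ → θ = θ₀) {θ : ℕ → E}
    (hθ : ∀ n, θ n ∈ Θ)
    (hmax : ∀ᶠ n in atTop, IsMaxOn (fun t => ∑ a, q n a * m a t) Θ (θ n)) :
    Tendsto θ atTop (𝓝 θ₀) := by
  -- By compactness it suffices to identify cluster points; along an ultrafilter the maximality
  -- inequality passes to the limit.
  refine hΘ.tendsto_nhds_of_unique_mapClusterPt (.of_forall hθ) fun t ht hcl => ?_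
  obtain ⟨U, hU, hUt⟩ := mapClusterPt_iff_ultrafilter.1 hcl
  refine huniq t ht ?_
  have h1 : Tendsto (fun n => ∑ a, q n a * m a θ₀) U (𝓝 (∑ a, w a * m a θ₀)) :=
    tendsto_finsetSum _ fun a _ => ((hq a).mono_left hU).mul_const _
  have h2 : Tendsto (fun n => ∑ a, q n a * m a (θ n)) U (𝓝 (∑ a, w a * m a t)) :=
    tendsto_finsetSum _ fun a _ => ((hq a).mono_left hU).mul <|
      (hm a t ht).tendsto.comp (tendsto_nhdsWithin_iff.2 ⟨hUt, .of_forall hθ⟩)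
  refine le_of_tendsto_of_tendsto h1 h2 ?_
  filter_upwards [hU hmax] with n hn using hn hθ₀

/-- Linearization of weighted estimating equations at the limit of their solutions. -/
theorem sub_sub_isLittleO_of_weighted_sum_eq_zero {E : Type*} [NormedAddCommGroup E]
    [NormedSpace ℝ E] {g : A → E → E} {g' : A → E →L[ℝ] E} {θ₀ : E}
    (hg : ∀ a, HasFDerivAt (g a) (g' a) θ₀) {q : ℕ → A → ℝ} {w : A → ℝ}
    (hq : ∀ a, Tendsto (fun n => q n a) atTop (𝓝 (w a))) {B : E →L[ℝ] E}
    (hB : ∀ v, B (∑ a, w a • g' a v) = -v) {θ : ℕ → E} (hθ : Tendsto θ atTop (𝓝 θ₀))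
    (hzero : ∀ᶠ n in atTop, ∑ a, q n a • g a (θ n) = 0) :
    (fun n => θ n - θ₀ - ∑ a, q n a • B (g a θ₀)) =o[atTop]
      fun n => ∑ a, q n a • B (g a θ₀) := by
  have h1 (a : A) : (fun n => q n a • (g a (θ n) - g a θ₀ - g' a (θ n - θ₀)))
      =o[atTop] fun n => θ n - θ₀ := by
    have := ((hq a).isBigO_one ℝ).smul_isLittleO ((hg a).isLittleO.comp_tendsto hθ)
    simpa [Function.comp_def] using this
  have h2 (a : A) : (fun n => (q n a - w a) • g' a (θ n - θ₀)) =o[atTop] fun n => θ n - θ₀ := by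
    have h0 : Tendsto (fun n => q n a - w a) atTop (𝓝 0) := by
      simpa using (hq a).sub_const (w a)
    have := ((Asymptotics.isLittleO_one_iff ℝ).2 h0).smul_isBigO
      ((g' a).isBigO_comp (fun n => θ n - θ₀) atTop)
    simpa using this
  have h3 : (fun n => ∑ a, (q n a • (g a (θ n) - g a θ₀ - g' a (θ n - θ₀))
      + (q n a - w a) • g' a (θ n - θ₀))) =o[atTop] fun n => θ n - θ₀ :=
    Asymptotics.IsLittleO.fun_sum fun a _ => (h1 a).add (h2 a)
  have h4 := ((B.isBigO_comp (fun n => ∑ a, (q n a • (g a (θ n) - g a θ₀ - g' a (θ n - θ₀))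
      + (q n a - w a) • g' a (θ n - θ₀))) atTop).trans_isLittleO h3)
  -- The error is first bounded relative to `θ n - θ₀`. Asymptotic equivalence is symmetric, so it
  -- is also small relative to the score average, and no prior rate of convergence for `θ n` is
  -- needed.
  have h5 : Asymptotics.IsEquivalent atTop (fun n => ∑ a, q n a • B (g a θ₀))
      (fun n => θ n - θ₀) := by
    refine (h4.neg_left).congr' ?_ EventuallyEq.rfl
    filter_upwards [hzero] with n hn
    have : ∑ a, (q n a • (g a (θ n) - g a θ₀ - g' a (θ n - θ₀))
      + (q n a - w a) • g' a (θ n - θ₀)) = ∑ a, q n a • g a (θ n) - ∑ a, q n a • g a θ₀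
        - ∑ a, w a • g' a (θ n - θ₀) := by
      rw [← Finset.sum_sub_distrib, ← Finset.sum_sub_distrib]
      refine Finset.sum_congr rfl fun a _ => ?_
      module
    rw [this, hn, zero_sub, map_sub, hB]
    simp only [map_neg, map_sum, map_smul, Pi.sub_apply]
    abel
  exact h5.symm

end Deterministic

/-! ### Asymptotic normality of M-estimators. -/

section MEstimator

open scoped Topology RealInnerProductSpace

variable {E Ω A : Type*} [NormedAddCommGroup E] [InnerProductSpace ℝ E] [FiniteDimensional ℝ E]
  [MeasurableSpace E] [BorelSpace E] [MeasurableSpace Ω] {P : Measure Ω} [IsProbabilityMeasure P]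
  [Fintype A] [MeasurableSpace A] [MeasurableSingletonClass A]

theorem integral_comp_eq_sum {Ω A : Type*} [MeasurableSpace Ω] {P : Measure Ω} [Fintype A]
    [MeasurableSpace A] [MeasurableSingletonClass A] {p : PMF A} {Z : Ω → A}
    (hlaw : HasLaw Z p.toMeasure P)
    (f : A → ℝ) : ∫ ω, f (Z ω) ∂P = ∑ a, (p a).toReal * f a := by
  rw [← integral_map hlaw.aemeasurable (measurable_of_finite f).aestronglyMeasurable,
    hlaw.map_eq, PMF.integral_eq_sum]
  rfl

theorem smul_sum_frequency_smul {A F : Type*} [Fintype A] [DecidableEq A] [AddCommGroup F]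
    [Module ℝ F] {n : ℕ} (hn : 0 < n) (z : ℕ → A) (f : A → F) :
    (n : ℝ) • ∑ a, ((∑ i ∈ Finset.range n, if z i = a then (1 : ℝ) else 0) / n) • f a
      = ∑ i ∈ Finset.range n, f (z i) := by
  have hn' : (n : ℝ) ≠ 0 := by positivity
  simp_rw [Finset.smul_sum, smul_smul, mul_div_cancel₀ _ hn', Finset.sum_smul]
  rw [Finset.sum_comm]
  simp

/-- Asymptotic normality of M-estimators for i.i.d. observations in a finite type: the estimators
maximize the sum of the criteria `m (Z i)` over a compact set `Θ`, the population criterion has the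
unique maximizer `θ₀`, which is interior, the gradients `g a` of the criteria are differentiable at
`θ₀`, and `-B` inverts the Hessian of the population criterion. -/
theorem tendstoInDistribution_mEstimator {p : PMF A} {m : A → E → ℝ} {g : A → E → E}
    {g' : A → E →L[ℝ] E} {B : E →L[ℝ] E} {Θ : Set E} {θ₀ : E} (hΘ : IsCompact Θ)
    (hθ₀ : θ₀ ∈ interior Θ) (hm : ∀ a, ContinuousOn (m a) Θ)
    (huniq : ∀ θ ∈ Θ, ∑ a, (p a).toReal * m a θ₀ ≤ ∑ a, (p a).toReal * m a θ → θ = θ₀)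
    (hgrad : ∀ᶠ θ in 𝓝 θ₀, ∀ a, HasGradientAt (m a) (g a θ) θ)
    (hg : ∀ a, HasFDerivAt (g a) (g' a) θ₀)
    (hmean : ∑ a, (p a).toReal • g a θ₀ = 0)
    (hB : ∀ v, B (∑ a, (p a).toReal • g' a v) = -v)
    {μ : Measure E} [IsProbabilityMeasure μ]
    (hμ : ∀ t, charFun μ t
      = Complex.exp (-(∑ a, (p a).toReal * ⟪B (g a θ₀), t⟫ ^ 2 : ℝ) / 2))
    {Z : ℕ → Ω → A} (hindep : iIndepFun Z P) (hlaw : ∀ i, HasLaw (Z i) p.toMeasure P)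
    {θhat : ℕ → Ω → E} (hmeas : ∀ n, AEMeasurable (θhat n) P)
    (hmax : ∀ n, ∀ᵐ ω ∂P, θhat n ω ∈ Θ ∧
      IsMaxOn (fun θ => ∑ i ∈ Finset.range n, m (Z i ω) θ) Θ (θhat n ω)) :
    TendstoInDistribution (fun (n : ℕ) ω => √(n : ℝ) • (θhat n ω - θ₀)) atTop (id : E → E)
      (fun _ => P) μ := by
  classical
  let h : A → E := fun a => B (g a θ₀)
  have hh : Measurable h := measurable_of_finite h
  have hclt : TendstoInDistribution
      (fun (n : ℕ) ω => (√(n : ℝ))⁻¹ • ∑ i ∈ Finset.range n, h (Z i ω)) atTop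
      (id : E → E) (fun _ => P) μ := by
    refine tendstoInDistribution_inv_sqrt_smul_sum (X := fun i ω => h (Z i ω))
      (hindep.comp (fun _ => h) fun _ => hh)
      (fun i => ((hlaw i).identDistrib (hlaw 0)).comp hh) ?_ (fun t => ?_) fun t => ?_
    · refine MemLp.of_bound (hh.comp_aemeasurable (hlaw 0).aemeasurable).aestronglyMeasurable
        (∑ a, ‖h a‖) (.of_forall fun ω => ?_)
      exact Finset.single_le_sum (f := fun a => ‖h a‖) (fun _ _ => norm_nonneg _)
        (Finset.mem_univ (Z 0 ω))
    · rw [integral_comp_eq_sum (hlaw 0) fun a => ⟪h a, t⟫]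
      have : ∑ a, (p a).toReal * ⟪h a, t⟫ = ⟪B (∑ a, (p a).toReal • g a θ₀), t⟫ := by
        simp [h, map_sum, sum_inner, inner_smul_left]
      rw [this, hmean, map_zero, inner_zero_left]
    · rw [integral_comp_eq_sum (hlaw 0) fun a => ⟪h a, t⟫ ^ 2, hμ]
  refine tendstoInDistribution_of_ae_sub_isLittleO hclt
    (fun n => ((hmeas n).sub_const _).const_smul _) ?_
  -- From here on `ω` is fixed and the argument is deterministic.
  filter_upwards [ae_tendsto_empirical_frequency p hindep hlaw, ae_all_iff.2 hmax] with ω hq hω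
  set q : ℕ → A → ℝ := fun n a =>
    (∑ i ∈ Finset.range n, if Z i ω = a then (1 : ℝ) else 0) / n
  have hmaxq {n : ℕ} (hn : 0 < n) :
      IsMaxOn (fun θ => ∑ a, q n a * m a θ) Θ (θhat n ω) := by
    intro θ hθ
    have := (hω n).2 hθ
    simp only [Set.mem_ofPred_eq] at this ⊢
    rw [← smul_sum_frequency_smul hn (fun i => Z i ω) fun a => m a θ,
      ← smul_sum_frequency_smul hn (fun i => Z i ω) fun a => m a (θhat n ω)] at this
    exact le_of_smul_le_smul_left this (by positivity)
  have hlim : Tendsto (fun n => θhat n ω) atTop (𝓝 θ₀) :=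
    tendsto_of_isMaxOn_weighted_sum hΘ hm hq (interior_subset hθ₀) huniq (fun n => (hω n).1)
      ((eventually_gt_atTop 0).mono fun n hn => hmaxq hn)
  have hzero : ∀ᶠ n in atTop, ∑ a, q n a • g a (θhat n ω) = 0 := by
    filter_upwards [hlim.eventually hgrad, hlim.eventually (isOpen_interior.mem_nhds hθ₀),
      eventually_gt_atTop 0] with n hgn hin hn
    have hloc : IsLocalMax (fun θ => ∑ a, q n a * m a θ) (θhat n ω) :=
      (hmaxq hn).isLocalMax (mem_interior_iff_mem_nhds.1 hin)
    have hder : HasFDerivAt (fun θ => ∑ a, q n a * m a θ)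
        (∑ a, q n a • InnerProductSpace.toDual ℝ E (g a (θhat n ω))) (θhat n ω) :=
      HasFDerivAt.fun_sum fun a _ => (hgn a).hasFDerivAt.const_mul (q n a)
    have := hloc.hasFDerivAt_eq_zero hder
    refine (InnerProductSpace.toDual ℝ E).injective ?_
    simpa [map_sum] using this
  have hlin := sub_sub_isLittleO_of_weighted_sum_eq_zero hg hq hB hlim hzero
  have hscale := (Asymptotics.isBigO_refl (fun n : ℕ => √(n : ℝ)) atTop).smul_isLittleO hlin
  have hW : ∀ᶠ n : ℕ in atTop, √(n : ℝ) • ∑ a, q n a • B (g a θ₀)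
      = (√(n : ℝ))⁻¹ • ∑ i ∈ Finset.range n, h (Z i ω) := by
    filter_upwards [eventually_gt_atTop 0] with n hn
    rw [← smul_sum_frequency_smul hn (fun i => Z i ω) h, smul_smul]
    congr 1
    have : (0 : ℝ) < √n := by positivity
    field_simp
    exact Real.sq_sqrt (by positivity)
  refine hscale.congr' ?_ hW
  filter_upwards [hW] with n hn
  rw [← hn, ← smul_sub]

end MEstimator

/-! ### Gibbs' inequality for unnormalized positive weights. -/

section Gibbs

variable {ι : Type*} [Fintype ι] {r q : ι → ℝ}

/-- This is `log u ≤ u - 1` at `u = b / a`, multiplied by `a`. -/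
theorem mul_log_sub_mul_log_le_sub {a b : ℝ} (ha : 0 < a) (hb : 0 < b) :
    a * Real.log b - a * Real.log a ≤ b - a := by
  have h1 := Real.log_le_sub_one_of_pos (div_pos hb ha)
  rw [Real.log_div hb.ne' ha.ne'] at h1
  have h2 := mul_le_mul_of_nonneg_left h1 ha.le
  rwa [mul_sub, mul_sub, mul_div_cancel₀ _ ha.ne', mul_one] at h2

theorem mul_log_sub_mul_log_lt_sub {a b : ℝ} (ha : 0 < a) (hb : 0 < b) (hab : b ≠ a) :
    a * Real.log b - a * Real.log a < b - a := by
  have h1 := Real.log_lt_sub_one_of_pos (div_pos hb ha) (by rwa [ne_eq, div_eq_one_iff_eq ha.ne'])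
  rw [Real.log_div hb.ne' ha.ne'] at h1
  have h2 := mul_lt_mul_of_pos_left h1 ha
  rwa [mul_sub, mul_sub, mul_div_cancel₀ _ ha.ne', mul_one] at h2

/-- **Gibbs' inequality.** -/
theorem sum_mul_log_le_sum_mul_log (hr : ∀ i, 0 < r i) (hq : ∀ i, 0 < q i)
    (h : ∑ i, q i ≤ ∑ i, r i) : ∑ i, r i * Real.log (q i) ≤ ∑ i, r i * Real.log (r i) := by
  have key := Finset.sum_le_sum fun i (_ : i ∈ Finset.univ) =>
    mul_log_sub_mul_log_le_sub (hr i) (hq i)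
  rw [Finset.sum_sub_distrib, Finset.sum_sub_distrib] at key
  linarith

/-- The equality case of Gibbs' inequality. -/
theorem eq_of_sum_mul_log_le (hr : ∀ i, 0 < r i) (hq : ∀ i, 0 < q i)
    (h : ∑ i, q i ≤ ∑ i, r i) (hle : ∑ i, r i * Real.log (r i) ≤ ∑ i, r i * Real.log (q i))
    (i : ι) : q i = r i := by
  by_contra hne
  have key := Finset.sum_lt_sum (fun j (_ : j ∈ Finset.univ) =>
    mul_log_sub_mul_log_le_sub (hr j) (hq j))
    ⟨i, Finset.mem_univ i, mul_log_sub_mul_log_lt_sub (hr i) (hq i) hne⟩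
  rw [Finset.sum_sub_distrib, Finset.sum_sub_distrib] at key
  linarith

end Gibbs

namespace CondModel

open scoped Topology RealInnerProductSpace

variable {X Y : Type*} [Fintype Y] {d : ℕ} {p : PMF (X × Y)}
  {s : X → Y → Param d → ℝ} {θ : Param d}

section Basic

theorem partitionFn_pos [Nonempty Y] (s : X → Y → Param d → ℝ) (x : X) (θ : Param d) :
    0 < partitionFn s x θ :=
  Finset.sum_pos (fun _ _ => Real.exp_pos _) Finset.univ_nonempty

theorem modelProb_pos (s : X → Y → Param d → ℝ) (θ : Param d) (x : X) (y : Y) :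
    0 < modelProb s θ x y :=
  have : Nonempty Y := ⟨y⟩
  div_pos (Real.exp_pos _) (partitionFn_pos s x θ)

theorem sum_modelProb [Nonempty Y] (s : X → Y → Param d → ℝ) (θ : Param d) (x : X) :
    ∑ y, modelProb s θ x y = 1 := by
  simp only [modelProb, ← Finset.sum_div]
  exact div_self (partitionFn_pos s x θ).ne'

theorem log_modelProb (s : X → Y → Param d → ℝ) (θ : Param d) (x : X) (y : Y) :
    Real.log (modelProb s θ x y) = s x y θ - Real.log (partitionFn s x θ) := by
  have : Nonempty Y := ⟨y⟩
  rw [modelProb, Real.log_div (Real.exp_pos _).ne' (partitionFn_pos s x θ).ne', Real.log_exp]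

theorem WellSpecified.jointProb_eq (h : WellSpecified p s θ) (hpX : ∀ x, 0 < marginalX p x)
    (x : X) (y : Y) : jointProb p x y = marginalX p x * modelProb s θ x y := by
  rw [← h x y, condProb, mul_div_cancel₀ _ (hpX x).ne']

end Basic

/-! ### The true parameter maximizes the ranking objective. -/

section Ranking

variable [Fintype X] {pN : PMF Y} {K : ℕ}

/-- Writing the data weight as a density ratio against `pN` makes the base measure exchangeable, so
the slot of the data point can be averaged over all `K + 1` positions. For fixed `x` and `y` the
inner sum is then a cross-entropy over slots, open to Gibbs' inequality. -/
theorem rankingObjective_eq_sum (hpN : ∀ y, pN y ≠ 0) (θ : Param d) :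
    (K + 1 : ℝ) * rankingObjective p pN K s θ =
      ∑ x : X, ∑ y : Fin (K + 1) → Y, (∏ k, (pN (y k)).toReal) *
        ∑ j, jointProb p x (y j) / (pN (y j)).toReal *
          Real.log (Real.exp (correctedScore pN s x (y j) θ) /
            ∑ k, Real.exp (correctedScore pN s x (y k) θ)) := by
  have hne (y : Y) : (pN y).toReal ≠ 0 := ENNReal.toReal_ne_zero.2 ⟨hpN y, pN.apply_ne_top y⟩
  rw [rankingObjective, Finset.mul_sum]
  refine Finset.sum_congr rfl fun x _ => ?_
  let F : Fin (K + 1) → (Fin (K + 1) → Y) → ℝ := fun j y =>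
    (∏ k, (pN (y k)).toReal) * (jointProb p x (y j) / (pN (y j)).toReal *
      Real.log (Real.exp (correctedScore pN s x (y j) θ) /
        ∑ k, Real.exp (correctedScore pN s x (y k) θ)))
  have hsymm (j : Fin (K + 1)) : ∑ y, F j y = ∑ y, F 0 y := by
    refine Fintype.sum_equiv ((Equiv.swap 0 j).arrowCongr (Equiv.refl Y)) _ _ fun y => ?_
    have hk (k) : (Equiv.swap 0 j).arrowCongr (Equiv.refl Y) y k = y (Equiv.swap 0 j k) := by
      simp [Equiv.arrowCongr, Equiv.symm_swap]
    simp only [F, hk, Equiv.swap_apply_left]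
    rw [Equiv.prod_comp (Equiv.swap 0 j) fun k => (pN (y k)).toReal,
      Equiv.sum_comp (Equiv.swap 0 j) fun k => Real.exp (correctedScore pN s x (y k) θ)]
  have h0 : ∑ y : Fin (K + 1) → Y, (jointProb p x (y 0) * ∏ i : Fin K, (pN (y i.succ)).toReal) *
      Real.log (Real.exp (correctedScore pN s x (y 0) θ) /
        ∑ k : Fin (K + 1), Real.exp (correctedScore pN s x (y k) θ)) = ∑ y, F 0 y := by
    refine Finset.sum_congr rfl fun y _ => ?_
    simp only [F]
    rw [Fin.prod_univ_succ, ← mul_assoc]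
    congr 1
    field_simp [hne (y 0)]
  rw [h0]
  simp_rw [Finset.mul_sum (s := (Finset.univ : Finset (Fin (K + 1))))]
  rw [Finset.sum_comm]
  change _ = ∑ j, ∑ y, F j y
  simp [hsymm]

theorem WellSpecified.mem_rankingMaximizers {Θ : Set (Param d)} (h : WellSpecified p s θ)
    (hθ : θ ∈ Θ) (hpX : ∀ x, 0 < marginalX p x) (hpN : ∀ y, pN y ≠ 0) :
    θ ∈ rankingMaximizers p pN K s Θ := by
  have hpos (y : Y) : 0 < (pN y).toReal := ENNReal.toReal_pos (hpN y) (pN.apply_ne_top y)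
  refine ⟨hθ, fun θ' _ => ?_⟩
  refine le_of_mul_le_mul_left ?_ (by positivity : (0 : ℝ) < K + 1)
  rw [rankingObjective_eq_sum hpN, rankingObjective_eq_sum hpN]
  refine Finset.sum_le_sum fun x _ => Finset.sum_le_sum fun y _ =>
    mul_le_mul_of_nonneg_left ?_ (Finset.prod_nonneg fun k _ => (hpos _).le)
  have : Nonempty Y := ⟨y 0⟩
  have hS (t : Param d) : 0 < ∑ k, Real.exp (correctedScore pN s x (y k) t) :=
    Finset.sum_pos (fun _ _ => Real.exp_pos _) Finset.univ_nonempty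
  set S := ∑ k, Real.exp (correctedScore pN s x (y k) θ) with hSdef
  -- At the true parameter the density ratios are proportional to the softmax weights, with a factor
  -- independent of `j`.
  have hr (j : Fin (K + 1)) : jointProb p x (y j) / (pN (y j)).toReal
      = marginalX p x / partitionFn s x θ * S *
        (Real.exp (correctedScore pN s x (y j) θ) / S) := by
    rw [h.jointProb_eq hpX, modelProb, correctedScore, Real.exp_sub, Real.exp_log (hpos _)]
    have : S ≠ 0 := (hS θ).ne'
    have := (partitionFn_pos s x θ).ne'
    have := (hpos (y j)).ne'
    field_simp
  simp_rw [hr, mul_assoc _ (Real.exp _ / S), ← Finset.mul_sum]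
  refine mul_le_mul_of_nonneg_left ?_
    (mul_nonneg (div_nonneg (hpX x).le (partitionFn_pos s x θ).le) (hS θ).le)
  refine sum_mul_log_le_sum_mul_log (fun j => div_pos (Real.exp_pos _) (hS θ))
    (fun j => div_pos (Real.exp_pos _) (hS θ')) ?_
  rw [← Finset.sum_div, ← Finset.sum_div, div_self (hS θ').ne', div_self (hS θ).ne']

end Ranking

/-! ### The conditional likelihood and its score. -/

section Likelihood

/-- Under identifiability the true parameter is the only maximizer of the population conditional
log-likelihood. -/
theorem WellSpecified.eq_of_le_sum_log_modelProb [Fintype X] {Θ : Set (Param d)} {θ' : Param d}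
    (h : WellSpecified p s θ) (hident : Identifiable s Θ θ) (hpX : ∀ x, 0 < marginalX p x)
    (hθ' : θ' ∈ Θ)
    (hle : ∑ a : X × Y, (p a).toReal * Real.log (modelProb s θ a.1 a.2)
      ≤ ∑ a : X × Y, (p a).toReal * Real.log (modelProb s θ' a.1 a.2)) : θ' = θ := by
  have hw (a : X × Y) : (p a).toReal = marginalX p a.1 * modelProb s θ a.1 a.2 :=
    h.jointProb_eq hpX a.1 a.2
  refine hident θ' hθ' ⟨fun x =>
    Real.log (partitionFn s x θ') - Real.log (partitionFn s x θ), fun x y => ?_⟩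
  have : Nonempty Y := ⟨y⟩
  have hp (t : Param d) (a : X × Y) : 0 < marginalX p a.1 * modelProb s t a.1 a.2 :=
    mul_pos (hpX _) (modelProb_pos _ _ _ _)
  have hsum (t : Param d) : ∑ a : X × Y, marginalX p a.1 * modelProb s t a.1 a.2
      = ∑ x, marginalX p x := by
    rw [Fintype.sum_prod_type]
    simp_rw [← Finset.mul_sum, sum_modelProb, mul_one]
  have hlog (t : Param d) (a : X × Y) : Real.log (marginalX p a.1 * modelProb s t a.1 a.2)
      = Real.log (marginalX p a.1) + Real.log (modelProb s t a.1 a.2) :=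
    Real.log_mul (hpX _).ne' (modelProb_pos _ _ _ _).ne'
  -- Gibbs' inequality is applied to the joint weights; the `log (marginalX p x)` terms are common
  -- to both sides and cancel.
  have heq := eq_of_sum_mul_log_le (hp θ) (hp θ') (by rw [hsum, hsum]) (by
    simp_rw [hw] at hle
    simp_rw [hlog, mul_add, Finset.sum_add_distrib]
    linarith) (x, y)
  have h2 := mul_left_cancel₀ (hpX x).ne' heq
  have h3 := congrArg Real.log h2
  rw [log_modelProb, log_modelProb] at h3
  linarith

/-- The score `∇_θ log p(y | x; θ)` of the conditional model. -/
noncomputable def score (s : X → Y → Param d → ℝ) (θ : Param d) (x : X) (y : Y) : Param d :=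
  gradient (s x y) θ - ∑ y', modelProb s θ x y' • gradient (s x y') θ

theorem hasGradientAt_log_modelProb {x : X} (h : ∀ y, DifferentiableAt ℝ (s x y) θ) (y : Y) :
    HasGradientAt (fun t => Real.log (modelProb s t x y)) (score s θ x y) θ := by
  have : Nonempty Y := ⟨y⟩
  have hs (y') := (h y').hasGradientAt.hasFDerivAt
  have hZ : HasFDerivAt (partitionFn s x)
      (∑ y', Real.exp (s x y' θ) • InnerProductSpace.toDual ℝ _ (gradient (s x y') θ)) θ :=
    HasFDerivAt.fun_sum fun y' _ => (hs y').exp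
  simp_rw [log_modelProb]
  have := (hs y).sub (hZ.log (partitionFn_pos s x θ).ne')
  rw [hasGradientAt_iff_hasFDerivAt]
  refine this.congr_fderiv ?_
  simp [score, modelProb, Finset.smul_sum, smul_smul, div_eq_inv_mul, map_sum]

theorem hasFDerivAt_modelProb {x : X} (h : ∀ y, DifferentiableAt ℝ (s x y) θ) (y : Y) :
    HasFDerivAt (fun t => modelProb s t x y)
      (modelProb s θ x y • InnerProductSpace.toDual ℝ _ (score s θ x y)) θ := by
  have := (hasGradientAt_log_modelProb h y).hasFDerivAt.exp
  simpa only [Real.exp_log (modelProb_pos s _ x y)] using this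

theorem sum_modelProb_smul_score (s : X → Y → Param d → ℝ) (θ : Param d) (x : X) :
    ∑ y, modelProb s θ x y • score s θ x y = 0 := by
  rcases isEmpty_or_nonempty Y with hY | hY
  · simp
  · simp_rw [score, smul_sub, Finset.sum_sub_distrib, ← Finset.sum_smul, sum_modelProb, one_smul,
      sub_self]

theorem differentiableAt_gradient {E : Type*} [NormedAddCommGroup E] [InnerProductSpace ℝ E]
    [CompleteSpace E] {f : E → ℝ} {t : E} (h : ContDiffAt ℝ 2 f t) :
    DifferentiableAt ℝ (gradient f) t := by
  have h1 : DifferentiableAt ℝ (fderiv ℝ f) t :=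
    (h.fderiv_right (m := 1) (by norm_num)).differentiableAt (by norm_num)
  let L : StrongDual ℝ E →L[ℝ] E :=
    (InnerProductSpace.toDual ℝ E).symm.toContinuousLinearEquiv.toContinuousLinearMap
  exact L.differentiableAt.comp t h1

theorem differentiableAt_score {x : X} (h : ∀ y, ContDiffAt ℝ 2 (s x y) θ) (y : Y) :
    DifferentiableAt ℝ (fun t => score s t x y) θ := by
  refine (differentiableAt_gradient (h y)).sub (DifferentiableAt.fun_sum fun y' _ => ?_)
  exact (hasFDerivAt_modelProb (fun y => (h y).differentiableAt (by norm_num))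
    y').differentiableAt.smul (differentiableAt_gradient (h y'))

/-- The conditional information identity: the mean of the derivative of the score is minus the
second moment of the score. -/
theorem sum_modelProb_smul_fderiv_score {x : X} (h : ∀ y, ContDiffAt ℝ 2 (s x y) θ)
    (v : Param d) :
    ∑ y, modelProb s θ x y • fderiv ℝ (fun t => score s t x y) θ v
      = -∑ y, (modelProb s θ x y * ⟪score s θ x y, v⟫) • score s θ x y := by
  -- Differentiate by the product rule the identity that the score has mean zero at every parameter.
  have h1 : HasFDerivAt (fun t => ∑ y, modelProb s t x y • score s t x y)
      (∑ y, (modelProb s θ x y • fderiv ℝ (fun t => score s t x y) θ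
        + (modelProb s θ x y • InnerProductSpace.toDual ℝ _ (score s θ x y)).smulRight
          (score s θ x y))) θ :=
    HasFDerivAt.fun_sum fun y _ =>
      (hasFDerivAt_modelProb (fun y => (h y).differentiableAt (by norm_num)) y).smul
        (differentiableAt_score h y).hasFDerivAt
  simp_rw [sum_modelProb_smul_score] at h1
  have h2 := congrArg (fun L => L v) (h1.unique (hasFDerivAt_const 0 θ))
  simp only [sum_apply, add_apply,
    Finset.sum_add_distrib] at h2
  simpa [Finset.sum_add_distrib] using eq_neg_of_add_eq_zero_left h2

end Likelihood

/-! ### The information matrix as second moment of the score. -/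

section Information

variable [Fintype X]

/-- Under correct specification the model mean subtracted in the score is the true conditional mean,
so the score is the centred gradient. -/
theorem WellSpecified.fisherInfo_eq (h : WellSpecified p s θ) (hpX : ∀ x, 0 < marginalX p x) :
    fisherInfo p s θ = ∑ a : X × Y, (p a).toReal •
      Matrix.vecMulVec (score s θ a.1 a.2).ofLp (score s θ a.1 a.2).ofLp := by
  have hw (x : X) (y : Y) : (p (x, y)).toReal = marginalX p x * modelProb s θ x y :=
    h.jointProb_eq hpX x y
  ext i j
  rw [Fintype.sum_prod_type]
  simp only [fisherInfo, condVar, condMean, h _ _, hw, Matrix.sum_apply, Matrix.smul_apply,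
    Matrix.of_apply, Matrix.vecMulVec_apply, score, smul_eq_mul, Finset.mul_sum, mul_assoc]
  rfl

theorem WellSpecified.posSemidef_fisherInfo (h : WellSpecified p s θ)
    (hpX : ∀ x, 0 < marginalX p x) : (fisherInfo p s θ).PosSemidef := by
  rw [h.fisherInfo_eq hpX]
  refine Matrix.posSemidef_sum _ fun a _ => ?_
  have := Matrix.posSemidef_vecMulVec_self_star (score s θ a.1 a.2).ofLp
  exact this.smul ENNReal.toReal_nonneg

theorem WellSpecified.toEuclideanCLM_fisherInfo_apply (h : WellSpecified p s θ)
    (hpX : ∀ x, 0 < marginalX p x) (v : Param d) :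
    Matrix.toEuclideanCLM (𝕜 := ℝ) (fisherInfo p s θ) v
      = ∑ a : X × Y, ((p a).toReal * ⟪score s θ a.1 a.2, v⟫) • score s θ a.1 a.2 := by
  rw [h.fisherInfo_eq hpX]
  ext i
  simp [Matrix.vecMulVec_mulVec, PiLp.inner_apply, dotProduct, mul_comm, mul_left_comm]

end Information

end CondModel

/-! ### Asymptotic normality of the conditional maximum likelihood estimator. -/

theorem mainTheorem8
    {X Y : Type*} [Fintype X] [Fintype Y]
    [MeasurableSpace X] [MeasurableSingletonClass X]
    [MeasurableSpace Y] [MeasurableSingletonClass Y]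
    {d : ℕ}
    -- the joint distribution, with positive marginals
    (p : PMF (X × Y))
    (hpX : ∀ x, 0 < CondModel.marginalX p x) (hpY : ∀ y, 0 < CondModel.marginalY p y)
    -- the negative sampling distribution and the number of negative samples
    (pN : PMF Y) (hpN : ∀ y, pN y ≠ 0) (K : ℕ) (hK : 1 ≤ K)
    -- the scoring function, the parameter set and the true parameter
    (s : X → Y → CondModel.Param d → ℝ)
    (Θ : Set (CondModel.Param d)) (θstar : CondModel.Param d)
    (hθstar : θstar ∈ Θ)
    (hmodel : CondModel.WellSpecified p s θstar)
    (hident : CondModel.Identifiable s Θ θstar)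
    (hcompact : IsCompact Θ)
    (hinterior : CondModel.rankingMaximizers p pN K s Θ ⊆ interior Θ)
    (hsmooth : ∀ x y, ContDiffOn ℝ 2 (s x y) Θ)
    (hinfo : IsUnit (CondModel.fisherInfo p s θstar).det)
    -- the i.i.d. sample
    {Ω : Type*} [MeasurableSpace Ω] (P : Measure Ω) [IsProbabilityMeasure P]
    (Z : ℕ → Ω → X × Y)
    (hindep : iIndepFun Z P) (hlaw : ∀ i, HasLaw (Z i) p.toMeasure P)
    -- the conditional maximum likelihood estimators
    (θhat : ℕ → Ω → CondModel.Param d)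
    (hmeas : ∀ n, AEMeasurable (θhat n) P)
    (hmle : ∀ n, ∀ᵐ ω ∂P, CondModel.IsCondMLE s Θ n (fun i => Z i ω) (θhat n ω)) :
    TendstoInDistribution
      (fun (n : ℕ) (ω : Ω) => √(n : ℝ) • (θhat n ω - θstar)) atTop
      (id : CondModel.Param d → CondModel.Param d) (fun _ => P)
      (multivariateGaussian 0 (CondModel.fisherInfo p s θstar)⁻¹) := by
  have hstar : θstar ∈ interior Θ :=
    hinterior (hmodel.mem_rankingMaximizers hθstar hpX hpN)
  have hsmooth' (x : X) (y : Y) {θ : CondModel.Param d} (hθ : θ ∈ interior Θ) :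
      ContDiffAt ℝ 2 (s x y) θ :=
    (hsmooth x y).contDiffAt (mem_interior_iff_mem_nhds.1 hθ)
  have hw (x : X) (y : Y) :
      (p (x, y)).toReal = CondModel.marginalX p x * CondModel.modelProb s θstar x y :=
    hmodel.jointProb_eq hpX x y
  set I := CondModel.fisherInfo p s θstar with hI
  have hinv : (I⁻¹).PosSemidef := (hmodel.posSemidef_fisherInfo hpX).inv
  set B : CondModel.Param d →L[ℝ] CondModel.Param d := Matrix.toEuclideanCLM (𝕜 := ℝ) I⁻¹ with hB
  have hBI (v : CondModel.Param d) : B (Matrix.toEuclideanCLM (𝕜 := ℝ) I v) = v := by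
    rw [hB, ← mul_apply_eq_comp, ← map_mul, Matrix.nonsing_inv_mul _ hinfo, map_one,
      one_apply_eq_self]
  have hIB (v : CondModel.Param d) : Matrix.toEuclideanCLM (𝕜 := ℝ) I (B v) = v := by
    rw [hB, ← mul_apply_eq_comp, ← map_mul, Matrix.mul_nonsing_inv _ hinfo, map_one,
      one_apply_eq_self]
  have hBsymm (u v : CondModel.Param d) : inner ℝ (B u) v = inner ℝ u (B v) := by
    have hsa : IsSelfAdjoint B := hinv.isHermitian.isSelfAdjoint.map _
    conv_lhs => rw [← hsa.adjoint_eq]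
    exact ContinuousLinearMap.adjoint_inner_left _ _ _
  refine tendstoInDistribution_mEstimator (p := p)
    (m := fun a θ => Real.log (CondModel.modelProb s θ a.1 a.2))
    (g := fun a θ => CondModel.score s θ a.1 a.2)
    (g' := fun a => fderiv ℝ (fun θ => CondModel.score s θ a.1 a.2) θstar)
    (B := B) hcompact hstar (fun a => ?_)
    (fun θ hθ => hmodel.eq_of_le_sum_log_modelProb hident hpX hθ) ?_
    (fun a => (CondModel.differentiableAt_score (fun y => hsmooth' a.1 y hstar) a.2).hasFDerivAt)
    ?_ (fun v => ?_) (fun t => ?_) hindep hlaw hmeas hmle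
  · have : Nonempty Y := ⟨a.2⟩
    simp_rw [CondModel.log_modelProb]
    refine (hsmooth a.1 a.2).continuousOn.sub (ContinuousOn.log ?_ fun θ _ =>
      (CondModel.partitionFn_pos s a.1 θ).ne')
    exact continuousOn_finsetSum _ fun y _ => (hsmooth a.1 y).continuousOn.rexp
  · filter_upwards [isOpen_interior.mem_nhds hstar] with θ hθ a
    exact CondModel.hasGradientAt_log_modelProb
      (fun y => (hsmooth' a.1 y hθ).differentiableAt (by norm_num)) a.2
  · simp_rw [Fintype.sum_prod_type, hw, mul_smul, ← Finset.smul_sum,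
      CondModel.sum_modelProb_smul_score, smul_zero, Finset.sum_const_zero]
  · have : ∑ a : X × Y, (p a).toReal •
        fderiv ℝ (fun θ => CondModel.score s θ a.1 a.2) θstar v
        = -Matrix.toEuclideanCLM (𝕜 := ℝ) I v := by
      rw [hmodel.toEuclideanCLM_fisherInfo_apply hpX]
      simp_rw [Fintype.sum_prod_type, hw, mul_assoc, mul_smul, ← Finset.smul_sum,
        CondModel.sum_modelProb_smul_fderiv_score (fun y => hsmooth' _ y hstar),
        smul_neg, Finset.sum_neg_distrib, mul_smul]
    rw [this, map_neg, hBI]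
  -- The sandwich covariance `B I B` collapses to `B`, as `B` is symmetric and inverts `I`.
  · have h1 : ∑ a : X × Y, (p a).toReal *
        inner ℝ (B (CondModel.score s θstar a.1 a.2)) t ^ 2 = inner ℝ t (B t) := by
      have : inner ℝ t (B t) = inner ℝ (Matrix.toEuclideanCLM (𝕜 := ℝ) I (B t)) (B t) := by
        rw [hIB]
      rw [this, hmodel.toEuclideanCLM_fisherInfo_apply hpX]
      simp_rw [sum_inner, inner_smul_left, hBsymm]
      exact Finset.sum_congr rfl fun a _ => by simp; ring
    rw [charFun_multivariateGaussian hinv, h1, hB, Matrix.inner_toEuclideanCLM]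
    simp [neg_div]
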